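/- Let $\mathcal X$ be a set of datasets with a symmetric neighboring relation $\sim$. For a randomized algorithm $M:\mathcal X\to\mathcal Y$ ($\mathcal Y$ an arbitrary measurable space) and $x\sim x'$ let $P=M(x)$, $Q=M(x')$ denote the output laws. $M$ is $(\varepsilon,\delta)$-DP if $P(S)\le e^{\varepsilon}Q(S)+\delta$ for all $x\sim x'$ and all events $S$, and $\varepsilon$-DP if it is $(\varepsilon,0)$-DP. $M$ is $\alpha$-BR (bounded range) if $P(y_1)/Q(y_1)\le e^{\alpha}P(y_2)/Q(y_2)$ for all $x\sim x'$ and all outcomes $y_1,y_2$; in general: $P(S_1)Q(S_2)\le e^{\alpha}P(S_2)Q(S_1)$ for all events $S_1,S_2$. $M$ is $(\mu,\tau)$-CDP if for all $x\sim x'$ the privacy loss $L=\log\frac{dP}{dQ}(y)$, $y\sim P$, is well defined ($P\ll Q$) and integrable, $\mathbb E[L]\le\mu$, and $\mathbb E[e^{\lambda(L-\mathbb E L)}]\le e^{\lambda^2\tau^2/2}$ for all $\lambda\in\mathbb R$. Let $\mathcal E=(e_i)_{i\in I}$ be a finite preregistered family, where each $e_i$ is a privacy parameter of one of these classes ($\varepsilon$-DP,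 $\alpha$-BR or $(\mu,\tau)$-CDP). In the $\mathcal E$-set-wise adaptive composition experiment $b\in\{0,1\}$ there are $|I|$ rounds. In each round $n$ (with outcomes in a measurable space $\mathcal Y_n$) the analyst chooses, as a deterministic measurable function of the previous outcomes, an index $i\in I$ not used before, a mechanism $M_n$ of the class described by $e_i$, and neighboring datasets $x_n^{(0)}\sim x_n^{(1)}$, and then observes an outcome of $M_n(x_n^{(b)})$. The view $V^{(b)}$ is the resulting sequence of outcomes. $\mathcal E$ is $(\varepsilon_g,\delta)$-differentially private under set-wise adaptive composition if for every analyst, every $b$ and every event $S$, $$\Pr[V^{(b)}\in S]\le e^{\varepsilon_g}\Pr[V^{(1-b)}\in S]+\delta .$$ (In the formulas below, for $\delta>1$ the square root is read as $0$; the claims are then trivial.) 1. Let $\mathcal E=\{(\mu_i,\tau_i): i\in[k]\}$ be CDP parameters. Then for every $\delta>0$, $\mathcal E$ is $(\varepsilon_g,\delta)$-differentially private under set-wise adaptive composition, where $$\varepsilon_g=\sum_{i\in[k]}\mu_i+\sqrt{2\sum_{i\in[k]}\tau_i^2\,\log(1/\delta)} .$$ 2. Let $\varepsilon,\alpha>0$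 and $\mu,\tau\in\mathbb R$, and let $\mathcal E$ consist of $m_{\mathrm{DP}}$ copies of the parameter $\varepsilon$ for $\varepsilon$-DP mechanisms, $m_{\mathrm{BR}}$ copies of the parameter $\alpha$ for $\alpha$-BR mechanisms, and $m_{\mathrm{CDP}}$ copies of the parameter $(\mu,\tau)$ for $(\mu,\tau)$-CDP mechanisms, so that the analyst chooses the class of the mechanism adaptively at each round. Then for every $\delta>0$, $\mathcal E$ is $(\varepsilon_g,\delta)$-differentially private under set-wise adaptive composition, where $$\varepsilon_g=m_{\mathrm{DP}}\,\varepsilon\,\frac{e^{\varepsilon}-1}{e^{\varepsilon}+1}+m_{\mathrm{BR}}\left(\frac{\alpha}{e^{\alpha}-1}-1-\log\frac{\alpha}{e^{\alpha}-1}\right)+m_{\mathrm{CDP}}\,\mu+\sqrt{2\left(m_{\mathrm{DP}}\varepsilon^2+\frac{m_{\mathrm{BR}}}{4}\alpha^2+m_{\mathrm{CDP}}\tau^2\right)\log(1/\delta)} .$$ -/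

import Mathlib

universe u v w

namespace PrivacyComposition

open MeasureTheory ProbabilityTheory

/-- A randomized algorithm with inputs in `X` and outcomes in the measurable space `Y`:
it assigns to every input a probability law on `Y`. -/
abbrev Mechanism (X : Type u) (Y : Type v) [MeasurableSpace Y] : Type (max u v) :=
  X → ProbabilityMeasure Y

section Guarantees

variable {X : Type u} {Y : Type v} [MeasurableSpace Y]

/-- `(ε, δ)`-differential privacy with respect to the neighboring relation `Nbr`. -/
def IsDP (Nbr : X → X → Prop) (M : Mechanism X Y) (ε δ : ℝ) : Prop :=
  ∀ x x' : X, Nbr x x' → ∀ S : Set Y, MeasurableSet S →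
    (M x : Measure Y) S ≤
      ENNReal.ofReal (Real.exp ε) * (M x' : Measure Y) S + ENNReal.ofReal δ

/-- `α`-bounded range: `P(y₁) / Q(y₁) ≤ e^α * (P(y₂) / Q(y₂))` for all outcomes `y₁`, `y₂`, where
`P = M x` and `Q = M x'`. The denominators are cleared and the outcomes are replaced by events, so
that the definition covers continuous outcome spaces; for countable ones it is the inequality above
for the point probabilities. -/
def IsBR (Nbr : X → X → Prop) (M : Mechanism X Y) (α : ℝ) : Prop :=
  ∀ x x' : X, Nbr x x' → ∀ S₁ S₂ : Set Y, MeasurableSet S₁ → MeasurableSet S₂ →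
    (M x : Measure Y) S₁ * (M x' : Measure Y) S₂ ≤
      ENNReal.ofReal (Real.exp α) * ((M x : Measure Y) S₂ * (M x' : Measure Y) S₁)

/-- `(μ, τ)`-concentrated differential privacy. The privacy loss is the log-likelihood ratio
`llr P Q = log (dP/dQ)` of `P = M x` and `Q = M x'`, evaluated at an outcome drawn from `P`; it is
a finite random variable only if `P ≪ Q`. -/
def IsCDP (Nbr : X → X → Prop) (M : Mechanism X Y) (μ τ : ℝ) : Prop :=
  ∀ x x' : X, Nbr x x' →
    let P : Measure Y := M x
    let Q : Measure Y := M x'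
    P ≪ Q ∧ Integrable (llr P Q) P ∧ (∫ y, llr P Q y ∂P) ≤ μ ∧
      ∀ l : ℝ,
        Integrable (fun y => Real.exp (l * (llr P Q y - ∫ z, llr P Q z ∂P))) P ∧
        (∫ y, Real.exp (l * (llr P Q y - ∫ z, llr P Q z ∂P)) ∂P) ≤ Real.exp (l ^ 2 * τ ^ 2 / 2)

end Guarantees

/-- A preregistered privacy parameter, together with the class of mechanisms it belongs to. -/
inductive PrivacyParam : Type
  | pureDP (ε : ℝ)
  | boundedRange (α : ℝ)
  | cdp (μ τ : ℝ)

/-- The mechanism `M` belongs to the class described by the privacy parameter. -/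
def PrivacyParam.Admits {X : Type u} {Y : Type v} [MeasurableSpace Y] (Nbr : X → X → Prop)
    (M : Mechanism X Y) : PrivacyParam → Prop
  | .pureDP ε => IsDP Nbr M ε 0
  | .boundedRange α => IsBR Nbr M α
  | .cdp μ τ => IsCDP Nbr M μ τ

/-- The outcomes of the first `n` rounds, where round `i` has its outcomes in `Y i`. -/
def History (Y : ℕ → Type v) : ℕ → Type v
  | 0 => PUnit
  | n + 1 => History Y n × Y n

/-- The product sigma-algebra on histories. -/
instance History.instMeasurableSpace (Y : ℕ → Type v) [inst : ∀ n, MeasurableSpace (Y n)] :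
    ∀ n, MeasurableSpace (History Y n)
  | 0 => (inferInstance : MeasurableSpace PUnit)
  | n + 1 => @Prod.instMeasurableSpace _ _ (History.instMeasurableSpace Y n) (inst n)

open Classical in
/-- The parameters still available after `n` rounds: all of them at the start, and each round
deletes the parameter that was selected in it. -/
noncomputable def remaining {ι : Type w} [Fintype ι] {Y : ℕ → Type v} {k : ℕ}
    (select : (n : Fin k) → History Y n → ι) : (n : ℕ) → n ≤ k → History Y n → Finset ι
  | 0, _, _ => Finset.univ
  | n + 1, hn, h => (remaining select n (Nat.le_of_succ_le hn) h.1).erase (select ⟨n, hn⟩ h.1)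

/-- An analyst in the set-wise adaptive composition experiment for the family `E` of preregistered
privacy parameters. There is one round for each parameter. In every round the analyst chooses, as a
function of the previous outcomes, one of the remaining parameters, a mechanism of the
corresponding class, and two neighboring datasets. -/
structure Analyst {X : Type u} (Nbr : X → X → Prop) {ι : Type w} [Fintype ι]
    (E : ι → PrivacyParam) (Y : ℕ → Type v) [∀ n, MeasurableSpace (Y n)] where
  select : (n : Fin (Fintype.card ι)) → History Y n → ι
  select_mem : ∀ (n : Fin (Fintype.card ι)) (h : History Y n),
    select n h ∈ remaining select n n.isLt.le h
  mech : (n : Fin (Fintype.card ι)) → History Y n → Mechanism X (Y n)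
  admits : ∀ (n : Fin (Fintype.card ι)) (h : History Y n), (E (select n h)).Admits Nbr (mech n h)
  data : Bool → (n : Fin (Fintype.card ι)) → History Y n → X
  nbr : ∀ (n : Fin (Fintype.card ι)) (h : History Y n), Nbr (data false n h) (data true n h)
  measurableSet_select : ∀ (n : Fin (Fintype.card ι)) (i : ι),
    MeasurableSet {h : History Y n | select n h = i}
  measurable_law : ∀ (b : Bool) (n : Fin (Fintype.card ι)),
    Measurable fun h : History Y n => (mech n h (data b n h) : Measure (Y n))

namespace Analyst

variable {X : Type u} {Nbr : X → X → Prop} {ι : Type w} [Fintype ι] {E : ι → PrivacyParam}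
  {Y : ℕ → Type v} [∀ n, MeasurableSpace (Y n)]

/-- The law of the outcome of round `n` given the previous outcomes, in experiment `b`. -/
noncomputable def outcome (A : Analyst Nbr E Y) (b : Bool) (n : ℕ) (hn : n < Fintype.card ι) :
    Kernel (History Y n) (Y n) where
  toFun h := (A.mech ⟨n, hn⟩ h (A.data b ⟨n, hn⟩ h) : Measure (Y n))
  measurable' := A.measurable_law b ⟨n, hn⟩

instance (A : Analyst Nbr E Y) (b : Bool) (n : ℕ) (hn : n < Fintype.card ι) :
    IsMarkovKernel (A.outcome b n hn) :=
  ⟨fun h => (A.mech ⟨n, hn⟩ h (A.data b ⟨n, hn⟩ h)).2⟩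

/-- The law of the outcomes of the first `n` rounds in experiment `b`. -/
noncomputable def historyLaw (A : Analyst Nbr E Y) (b : Bool) :
    (n : ℕ) → n ≤ Fintype.card ι → Measure (History Y n)
  | 0, _ => Measure.dirac PUnit.unit
  | n + 1, hn =>
    Measure.compProd (historyLaw A b n (Nat.le_of_succ_le hn)) (A.outcome b n hn)

theorem isProbabilityMeasure_historyLaw (A : Analyst Nbr E Y) (b : Bool) :
    ∀ (n : ℕ) (hn : n ≤ Fintype.card ι), IsProbabilityMeasure (A.historyLaw b n hn)
  | 0, _ => by
    unfold historyLaw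
    exact Measure.dirac.isProbabilityMeasure
  | n + 1, hn => by
    have := isProbabilityMeasure_historyLaw A b n (Nat.le_of_succ_le hn)
    exact inferInstanceAs (IsProbabilityMeasure
      (Measure.compProd (A.historyLaw b n (Nat.le_of_succ_le hn)) (A.outcome b n hn)))

/-- The law of the view of the analyst in experiment `b`: all outcomes of the interaction, which
runs until no parameter remains. (The choices of the analyst are functions of the outcomes.) -/
noncomputable def view (A : Analyst Nbr E Y) (b : Bool) : Measure (History Y (Fintype.card ι)) :=
  A.historyLaw b (Fintype.card ι) le_rfl

end Analyst

/-- The family `E` of privacy parameters is `(ε, δ)`-differentially private under set-wise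
adaptive composition. -/
def SetwiseDP {X : Type u} (Nbr : X → X → Prop) {ι : Type w} [Fintype ι]
    (E : ι → PrivacyParam) (ε δ : ℝ) : Prop :=
  ∀ (Y : ℕ → Type v) [∀ n, MeasurableSpace (Y n)] (A : Analyst Nbr E Y) (b : Bool)
    (S : Set (History Y (Fintype.card ι))), MeasurableSet S →
    A.view b S ≤ ENNReal.ofReal (Real.exp ε) * A.view (!b) S + ENNReal.ofReal δ

end PrivacyComposition

/-!
Every mechanism class reduces to a concentrated privacy loss. If the log-likelihood ratio `L` of `P`
with respect to `Q` lies in `[s, s + a]`, then Hoeffding's lemma makes it sub-Gaussian with variance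
proxy `(a / 2) ^ 2`, and integrating the chord bound for `exp (-x)` against `P`, where
`𝔼[exp (-L)] = 1`, bounds its mean. Pure differential privacy confines `L` to `[-ε, ε]`, bounded
range to some interval of length `α`; in the second case the mean bound is maximized over `s`.

A concentrated loss bounds the `L^p(Q)` norm of `dP/dQ`, and by Hölder's inequality
`∫ f dP ≤ C * (∫ f ^ q dQ) ^ q⁻¹` for all `f ≥ 0`. In this dual form the bounds multiply along
adaptive rounds. Weighting each history by the constants of the parameters that are still available
makes the total the product over all parameters, in whatever order the analyst spends them. Young's
inequality turns the resulting bound for events into an additive error, and optimizing `p` gives the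
square root.
-/

namespace PrivacyComposition

open MeasureTheory ProbabilityTheory Filter Real
open scoped ENNReal NNReal Topology

section LogLikelihoodRatio

variable {Y : Type v} [MeasurableSpace Y] {P Q : Measure Y}

theorem rnDeriv_le_of_le_smul [SigmaFinite Q] {c : ℝ≥0∞} (h : P ≤ c • Q) :
    ∀ᵐ y ∂Q, P.rnDeriv Q y ≤ c :=
  ae_le_of_forall_setLIntegral_le_of_sigmaFinite (Measure.measurable_rnDeriv P Q) fun S _ _ => by
    rw [setLIntegral_const]
    exact (Measure.setLIntegral_rnDeriv_le S).trans (h S)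

theorem llr_le_of_le_smul [SigmaFinite P] [SigmaFinite Q] {c : ℝ}
    (h : P ≤ ENNReal.ofReal (exp c) • Q) : ∀ᵐ y ∂P, llr P Q y ≤ c := by
  have hPQ : P ≪ Q := Measure.absolutelyContinuous_of_le_smul h
  filter_upwards [exp_llr_of_ac P Q hPQ, hPQ.ae_le (rnDeriv_le_of_le_smul h)] with y h_exp h_le
  have := ENNReal.toReal_le_of_le_ofReal (exp_pos c).le h_le
  rwa [← h_exp, exp_le_exp] at this

theorem neg_le_llr_of_le_smul [SigmaFinite P] [SigmaFinite Q] (hPQ : P ≪ Q) {c : ℝ}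
    (h : Q ≤ ENNReal.ofReal (exp c) • P) : ∀ᵐ y ∂P, -c ≤ llr P Q y := by
  filter_upwards [neg_llr hPQ, hPQ.ae_le (llr_le_of_le_smul h)] with y h_neg h_le
  rw [← h_neg, Pi.neg_apply] at h_le
  linarith

theorem measure_llr_le_le [SigmaFinite P] [SigmaFinite Q] (hPQ : P ≪ Q) (c : ℝ) :
    P {y | llr P Q y ≤ c} ≤ ENNReal.ofReal (exp c) * Q {y | llr P Q y ≤ c} := by
  rw [← Measure.setLIntegral_rnDeriv hPQ, ← setLIntegral_const]
  refine setLIntegral_mono_ae measurable_const.aemeasurable ?_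
  filter_upwards [Measure.rnDeriv_ne_top P Q] with y h_top hy
  exact ENNReal.le_ofReal_iff_toReal_le h_top (exp_pos c).le |>.2
    ((le_exp_log _).trans (exp_le_exp.2 hy))

theorem integral_exp_neg_llr [SigmaFinite P] [SigmaFinite Q] (hPQ : P ≪ Q) (hQP : Q ≪ P) :
    ∫ y, exp (-llr P Q y) ∂P = Q.real Set.univ := by
  rw [integral_congr_ae (exp_neg_llr hPQ), Measure.integral_toReal_rnDeriv hQP]

theorem lintegral_rnDeriv_rpow_one_add [SigmaFinite P] [SigmaFinite Q] (hPQ : P ≪ Q)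
    {l : ℝ} (hl : 0 ≤ l) :
    ∫⁻ y, P.rnDeriv Q y ^ (1 + l) ∂Q = ∫⁻ y, ENNReal.ofReal (exp (l * llr P Q y)) ∂P := by
  have h_meas : Measurable (P.rnDeriv Q) := Measure.measurable_rnDeriv P Q
  calc ∫⁻ y, P.rnDeriv Q y ^ (1 + l) ∂Q
      = ∫⁻ y, P.rnDeriv Q y * P.rnDeriv Q y ^ l ∂Q := by
        simp only [ENNReal.rpow_add_of_nonneg _ _ zero_le_one hl, ENNReal.rpow_one]
    _ = ∫⁻ y, P.rnDeriv Q y ^ l ∂P := lintegral_rnDeriv_mul hPQ (h_meas.pow_const l).aemeasurable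
    _ = ∫⁻ y, ENNReal.ofReal (exp (l * llr P Q y)) ∂P := by
        refine lintegral_congr_ae ?_
        filter_upwards [exp_llr_of_ac P Q hPQ, hPQ.ae_le (Measure.rnDeriv_ne_top P Q)]
          with y h_exp h_top
        rw [mul_comm, exp_mul, ← ENNReal.ofReal_rpow_of_pos (exp_pos _), h_exp,
          ENNReal.ofReal_toReal h_top]

end LogLikelihoodRatio

section BoundedLoss

theorem le_mul_one_sub_exp_neg {a x : ℝ} (ha : 0 < a) (hx₀ : 0 ≤ x) (hxa : x ≤ a) :
    x ≤ a / (1 - exp (-a)) * (1 - exp (-x)) := by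
  have h_chord := convexOn_exp.2 (Set.mem_univ 0) (Set.mem_univ (-a))
    (sub_nonneg.2 ((div_le_one ha).2 hxa)) (div_nonneg hx₀ ha.le) (by ring)
  have h_arg : x / a * -a = -x := by field_simp
  simp only [smul_eq_mul, mul_zero, zero_add, exp_zero, mul_one, h_arg] at h_chord
  have h_pos : 0 < 1 - exp (-a) := by simpa using ha
  rw [div_mul_eq_mul_div, le_div_iff₀ h_pos, ← div_le_iff₀' ha, mul_div_right_comm]
  linarith

theorem add_one_sub_exp_mul_le {B : ℝ} (hB : 0 < B) (s : ℝ) :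
    s + (1 - exp s) * B ≤ B - 1 - log B := by
  have := log_le_sub_one_of_pos (mul_pos (exp_pos s) hB)
  rw [log_mul (exp_ne_zero s) hB.ne', log_exp] at this
  linarith

variable {Y : Type v} [MeasurableSpace Y] {P Q : Measure Y}

theorem integral_llr_le_of_mem_Icc [IsProbabilityMeasure P] [IsProbabilityMeasure Q]
    (hPQ : P ≪ Q) (hQP : Q ≪ P) {s a : ℝ} (ha : 0 < a)
    (h : ∀ᵐ y ∂P, llr P Q y ∈ Set.Icc s (s + a)) :
    ∫ y, llr P Q y ∂P ≤ s + (1 - exp s) * (a / (1 - exp (-a))) := by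
  set B := a / (1 - exp (-a)) with hB
  have h_int : Integrable (fun y => exp (-llr P Q y)) P :=
    (integrable_congr (exp_neg_llr hPQ)).2 Measure.integrable_toReal_rnDeriv
  have h_le : ∀ᵐ y ∂P, llr P Q y ≤ s + B - B * exp s * exp (-llr P Q y) := by
    filter_upwards [h] with y hy
    have h_chord := le_mul_one_sub_exp_neg ha (sub_nonneg.2 hy.1) (sub_le_iff_le_add'.2 hy.2)
    rw [neg_sub, sub_eq_add_neg s, exp_add, ← hB] at h_chord
    linarith
  calc ∫ y, llr P Q y ∂P
      ≤ ∫ y, (s + B - B * exp s * exp (-llr P Q y)) ∂P :=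
        integral_mono_ae (Integrable.of_mem_Icc _ _ (measurable_llr P Q).aemeasurable h)
          ((integrable_const _).sub (h_int.const_mul _)) h_le
    _ = s + B - B * exp s := by
        rw [integral_sub (integrable_const _) (h_int.const_mul _), integral_const_mul,
          integral_exp_neg_llr hPQ hQP]
        simp
    _ = s + (1 - exp s) * B := by ring

theorem exists_mem_Icc_of_frequently_le {f : Y → ℝ} [NeZero P] {m M a : ℝ}
    (hf : ∀ᵐ y ∂P, f y ∈ Set.Icc m M)
    (h : ∀ c, (∃ᶠ y in ae P, f y ≤ c) → ∀ᵐ y ∂P, f y ≤ a + c) :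
    ∃ s, ∀ᵐ y ∂P, f y ∈ Set.Icc s (s + a) := by
  have h_below : IsBoundedUnder (· ≥ ·) (ae P) f := isBoundedUnder_of_eventually_ge
    (hf.mono fun y hy => hy.1)
  have h_above : IsBoundedUnder (· ≤ ·) (ae P) f := isBoundedUnder_of_eventually_le
    (hf.mono fun y hy => hy.2)
  have h_osc : essSup f P - a ≤ essInf f P := by
    refine le_of_forall_gt_imp_ge_of_dense fun c hc => ?_
    have h_freq : ∃ᶠ y in ae P, f y < c :=
      frequently_lt_of_liminf_lt h_above.isCoboundedUnder_ge hc
    linarith [essSup_le_of_ae_le (a + c) (h c (h_freq.mono fun y hy => hy.le))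
      h_below.isCoboundedUnder_le]
  refine ⟨essInf f P, ?_⟩
  filter_upwards [ae_essInf_le h_below, ae_le_essSup h_above] with y h_inf h_sup
  exact ⟨h_inf, by linarith⟩

theorem llr_le_of_mul_le_mul [SigmaFinite P] [IsFiniteMeasure Q] (hPQ : P ≪ Q) {a c : ℝ}
    (h : ∀ S₁ S₂, MeasurableSet S₁ → MeasurableSet S₂ →
      P S₁ * Q S₂ ≤ ENNReal.ofReal (exp a) * (P S₂ * Q S₁))
    (hc : ∃ᶠ y in ae P, llr P Q y ≤ c) : ∀ᵐ y ∂P, llr P Q y ≤ a + c := by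
  set T := {y | llr P Q y ≤ c}
  have hT : MeasurableSet T := measurableSet_le (measurable_llr P Q) measurable_const
  have hQT : Q T ≠ 0 := fun h_null => frequently_ae_iff.1 hc (hPQ h_null)
  refine llr_le_of_le_smul (Measure.le_iff.2 fun S hS => ?_)
  refine (ENNReal.mul_le_mul_iff_left hQT (measure_ne_top Q T)).1 ?_
  calc P S * Q T
      ≤ ENNReal.ofReal (exp a) * (P T * Q S) := h S T hS hT
    _ ≤ ENNReal.ofReal (exp a) * (ENNReal.ofReal (exp c) * Q T * Q S) := by
        gcongr
        exact measure_llr_le_le hPQ c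
    _ = (ENNReal.ofReal (exp (a + c)) • Q) S * Q T := by
        rw [exp_add, ENNReal.ofReal_mul (exp_pos a).le, Measure.smul_apply, smul_eq_mul]
        ring

end BoundedLoss

section ConcentratedLoss

variable {Y : Type v} [MeasurableSpace Y] {P Q : Measure Y}

/-- The privacy loss of `P` against `Q` has mean at most `m` and is sub-Gaussian around its mean
with variance proxy `c`: this is `(m, √c)`-concentrated differential privacy for a single pair of
output laws. -/
structure ConcentratedLoss (P Q : Measure Y) (m : ℝ) (c : ℝ≥0) : Prop where
  absolutelyContinuous : P ≪ Q
  integrable_llr : Integrable (llr P Q) P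
  integral_llr_le : ∫ y, llr P Q y ∂P ≤ m
  hasSubgaussianMGF : HasSubgaussianMGF (fun y => llr P Q y - ∫ z, llr P Q z ∂P) c P

theorem ConcentratedLoss.mono {m m' : ℝ} {c : ℝ≥0} (h : ConcentratedLoss P Q m c) (hm : m ≤ m') :
    ConcentratedLoss P Q m' c :=
  { h with integral_llr_le := h.integral_llr_le.trans hm }

theorem ConcentratedLoss.of_llr_mem_Icc [IsProbabilityMeasure P] [IsProbabilityMeasure Q]
    (hPQ : P ≪ Q) (hQP : Q ≪ P) {s a : ℝ} (ha : 0 < a)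
    (h : ∀ᵐ y ∂P, llr P Q y ∈ Set.Icc s (s + a)) :
    ConcentratedLoss P Q (s + (1 - exp s) * (a / (1 - exp (-a)))) ((‖a‖₊ / 2) ^ 2) where
  absolutelyContinuous := hPQ
  integrable_llr := Integrable.of_mem_Icc _ _ (measurable_llr P Q).aemeasurable h
  integral_llr_le := integral_llr_le_of_mem_Icc hPQ hQP ha h
  hasSubgaussianMGF := by
    simpa only [add_sub_cancel_left] using
      hasSubgaussianMGF_of_mem_Icc (measurable_llr P Q).aemeasurable h

theorem ConcentratedLoss.of_le_smul [IsProbabilityMeasure P] [IsProbabilityMeasure Q] {a : ℝ}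
    (ha : 0 < a) (hP : P ≤ ENNReal.ofReal (exp a) • Q) (hQ : Q ≤ ENNReal.ofReal (exp a) • P) :
    ConcentratedLoss P Q (a * ((exp a - 1) / (exp a + 1))) (‖a‖₊ ^ 2) := by
  have hPQ : P ≪ Q := Measure.absolutelyContinuous_of_le_smul hP
  have hQP : Q ≪ P := Measure.absolutelyContinuous_of_le_smul hQ
  have h_llr : ∀ᵐ y ∂P, llr P Q y ∈ Set.Icc (-a) (-a + 2 * a) := by
    filter_upwards [neg_le_llr_of_le_smul hPQ hQ, llr_le_of_le_smul hP] with y h_ge h_le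
    exact ⟨h_ge, by linarith⟩
  have h_mean : -a + (1 - exp (-a)) * (2 * a / (1 - exp (-(2 * a)))) =
      a * ((exp a - 1) / (exp a + 1)) := by
    have h_ne : exp a - 1 ≠ 0 := (sub_pos.2 (one_lt_exp_iff.2 ha)).ne'
    have h_sq : 1 - exp (-(2 * a)) = (exp a - 1) * (exp a + 1) / exp a ^ 2 := by
      rw [exp_neg, two_mul, exp_add]
      field_simp
      ring
    rw [h_sq, exp_neg]
    field_simp
    ring
  have h_proxy : (‖2 * a‖₊ / 2) ^ 2 = ‖a‖₊ ^ 2 := by simp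
  simpa only [h_mean, h_proxy] using ConcentratedLoss.of_llr_mem_Icc hPQ hQP (by positivity) h_llr

theorem ConcentratedLoss.of_mul_le_mul [IsProbabilityMeasure P] [IsProbabilityMeasure Q] {a : ℝ}
    (ha : 0 < a) (h : ∀ S₁ S₂, MeasurableSet S₁ → MeasurableSet S₂ →
      P S₁ * Q S₂ ≤ ENNReal.ofReal (exp a) * (P S₂ * Q S₁)) :
    ConcentratedLoss P Q (a / (exp a - 1) - 1 - log (a / (exp a - 1))) ((‖a‖₊ / 2) ^ 2) := by
  have hP : P ≤ ENNReal.ofReal (exp a) • Q := Measure.le_iff.2 fun S hS => by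
    simpa using h S Set.univ hS .univ
  have hQ : Q ≤ ENNReal.ofReal (exp a) • P := Measure.le_iff.2 fun S hS => by
    simpa using h Set.univ S .univ hS
  have hPQ : P ≪ Q := Measure.absolutelyContinuous_of_le_smul hP
  have hQP : Q ≪ P := Measure.absolutelyContinuous_of_le_smul hQ
  obtain ⟨s, hs⟩ := exists_mem_Icc_of_frequently_le
    ((neg_le_llr_of_le_smul hPQ hQ).and (llr_le_of_le_smul hP))
    fun _ => llr_le_of_mul_le_mul hPQ h
  have h_pos : 0 < exp a - 1 := sub_pos.2 (one_lt_exp_iff.2 ha)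
  have hB : a / (1 - exp (-a)) = exp a * (a / (exp a - 1)) := by
    rw [exp_neg]
    field_simp
  have hB' : a / (1 - exp (-a)) = a / (exp a - 1) + a := by
    rw [hB]
    field_simp
    ring
  refine (ConcentratedLoss.of_llr_mem_Icc hPQ hQP ha hs).mono ?_
  calc s + (1 - exp s) * (a / (1 - exp (-a)))
      ≤ a / (1 - exp (-a)) - 1 - log (a / (1 - exp (-a))) :=
        add_one_sub_exp_mul_le (hB ▸ by positivity) s
    _ = a / (exp a - 1) - 1 - log (a / (exp a - 1)) := by
        nth_rw 1 [hB']
        rw [hB, log_mul (exp_ne_zero a) (by positivity), log_exp]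
        ring

theorem ConcentratedLoss.lintegral_exp_mul_llr_le {m : ℝ} {c : ℝ≥0} (h : ConcentratedLoss P Q m c)
    {l : ℝ} (hl : 0 ≤ l) :
    ∫⁻ y, ENNReal.ofReal (exp (l * llr P Q y)) ∂P ≤
      ENNReal.ofReal (exp (l * m + c * l ^ 2 / 2)) := by
  set E := ∫ y, llr P Q y ∂P
  have h_split (y : Y) : exp (l * llr P Q y) = exp (l * E) * exp (l * (llr P Q y - E)) := by
    rw [← exp_add]
    ring_nf
  simp_rw [h_split]
  rw [← ofReal_integral_eq_lintegral_ofReal ((h.hasSubgaussianMGF.integrable_exp_mul l).const_mul _)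
    (ae_of_all _ fun y => by positivity), integral_const_mul, exp_add]
  gcongr
  · exact h.integral_llr_le
  · exact h.hasSubgaussianMGF.mgf_le l

end ConcentratedLoss

section LqDominated

variable {Y : Type v} [MeasurableSpace Y] {P Q : Measure Y} {p q : ℝ}

/-- Integration against `P` is bounded by `C` on nonnegative functions in `L^q(Q)`. For conjugate
`p` and `q` this says that the `L^p(Q)` norm of `dP/dQ` is at most `C`, which is a bound on the
Rényi divergence of order `p`; the dual form is chosen because composing it along kernels needs no
jointly measurable densities. -/
def LqDominated (P Q : Measure Y) (q : ℝ) (C : ℝ≥0∞) : Prop :=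
  ∀ f : Y → ℝ≥0∞, Measurable f → ∫⁻ y, f y ∂P ≤ C * (∫⁻ y, f y ^ q ∂Q) ^ q⁻¹

theorem LqDominated.of_absolutelyContinuous [SFinite P] [SigmaFinite Q] (hPQ : P ≪ Q)
    (hpq : p.HolderConjugate q) :
    LqDominated P Q q ((∫⁻ y, P.rnDeriv Q y ^ p ∂Q) ^ p⁻¹) := fun f hf => by
  rw [← lintegral_rnDeriv_mul hPQ hf.aemeasurable]
  simpa only [one_div, Pi.mul_apply] using ENNReal.lintegral_mul_le_Lp_mul_Lq Q hpq
    (Measure.measurable_rnDeriv P Q).aemeasurable hf.aemeasurable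

theorem LqDominated.mono {C C' : ℝ≥0∞} (h : LqDominated P Q q C) (hC : C ≤ C') :
    LqDominated P Q q C' :=
  fun f hf => (h f hf).trans (by gcongr)

theorem ConcentratedLoss.lqDominated [SigmaFinite P] [SigmaFinite Q] {m : ℝ} {c : ℝ≥0}
    (h : ConcentratedLoss P Q m c) {l : ℝ} (hl : 0 ≤ l) (hq : (1 + l).HolderConjugate q) :
    LqDominated P Q q (ENNReal.ofReal (exp ((l * m + c * l ^ 2 / 2) / (1 + l)))) := by
  refine (LqDominated.of_absolutelyContinuous h.absolutelyContinuous hq).mono ?_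
  rw [lintegral_rnDeriv_rpow_one_add h.absolutelyContinuous hl, div_eq_mul_inv, exp_mul,
    ← ENNReal.ofReal_rpow_of_pos (exp_pos _)]
  exact ENNReal.rpow_le_rpow (h.lintegral_exp_mul_llr_le hl) hq.inv_nonneg

theorem lqDominated_dirac_smul (hq : q ≠ 0) (C : ℝ≥0∞) (y : Y) :
    LqDominated (C • Measure.dirac y) (Measure.dirac y) q C := fun f hf => by
  rw [lintegral_smul_measure, lintegral_dirac' y hf, lintegral_dirac' y (hf.pow_const q),
    ENNReal.rpow_rpow_inv hq, smul_eq_mul]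

theorem LqDominated.compProd {Z : Type*} [MeasurableSpace Z] [SFinite P] [SFinite Q]
    {κ η : Kernel Y Z} [IsSFiniteKernel κ] [IsSFiniteKernel η] (hq : q ≠ 0) {C : ℝ≥0∞}
    {c w w' : Y → ℝ≥0∞} (hw : Measurable w) (hw' : Measurable fun z : Y × Z => w' z.1)
    (hcw : ∀ y, c y * w' y = w y) (hPQ : LqDominated (P.withDensity w) Q q C)
    (hκη : ∀ y, LqDominated (κ y) (η y) q (c y)) :
    LqDominated ((P ⊗ₘ κ).withDensity fun z => w' z.1) (Q ⊗ₘ η) q C := fun f hf => by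
  have hfq : Measurable fun z => f z ^ q := hf.pow_const q
  have hF : Measurable fun y => (∫⁻ z, f (y, z) ^ q ∂(η y)) ^ q⁻¹ :=
    hfq.lintegral_kernel_prod_right'.pow_const _
  calc ∫⁻ z, f z ∂((P ⊗ₘ κ).withDensity fun z => w' z.1)
      = ∫⁻ y, w' y * ∫⁻ z, f (y, z) ∂(κ y) ∂P := by
        rw [lintegral_withDensity_eq_lintegral_mul _ hw' hf,
          Measure.lintegral_compProd (hw'.mul hf)]
        refine lintegral_congr fun y => ?_
        simp only [Pi.mul_apply]
        exact lintegral_const_mul _ (hf.comp measurable_prodMk_left)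
    _ ≤ ∫⁻ y, w y * (∫⁻ z, f (y, z) ^ q ∂(η y)) ^ q⁻¹ ∂P := by
        refine lintegral_mono fun y => ?_
        rw [← hcw, mul_comm (c y), mul_assoc]
        gcongr
        exact hκη y _ (hf.comp measurable_prodMk_left)
    _ = ∫⁻ y, (∫⁻ z, f (y, z) ^ q ∂(η y)) ^ q⁻¹ ∂(P.withDensity w) :=
        (lintegral_withDensity_eq_lintegral_mul _ hw hF).symm
    _ ≤ C * (∫⁻ y, ((∫⁻ z, f (y, z) ^ q ∂(η y)) ^ q⁻¹) ^ q ∂Q) ^ q⁻¹ := hPQ _ hF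
    _ = C * (∫⁻ z, f z ^ q ∂(Q ⊗ₘ η)) ^ q⁻¹ := by
        simp only [ENNReal.rpow_inv_rpow hq, Measure.lintegral_compProd hfq]

theorem LqDominated.measure_le {C : ℝ≥0∞} (hq : 0 < q) (h : LqDominated P Q q C) {S : Set Y}
    (hS : MeasurableSet S) : P S ≤ C * Q S ^ q⁻¹ := by
  have h_rpow : (fun y => S.indicator (1 : Y → ℝ≥0∞) y ^ q) = S.indicator 1 := by
    ext y
    by_cases hy : y ∈ S <;> simp [hy, hq]
  simpa only [h_rpow, lintegral_indicator_one hS] using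
    h (S.indicator 1) (measurable_one.indicator hS)

theorem ofReal_exp_mul_rpow_inv_le (hpq : p.HolderConjugate q) (r t : ℝ) (x : ℝ≥0∞) :
    ENNReal.ofReal (exp r) * x ^ q⁻¹ ≤
      ENNReal.ofReal (exp t) * x + ENNReal.ofReal (exp (p * r - (p - 1) * t)) := by
  set a := ENNReal.ofReal (exp (r - t / q))
  set b := (ENNReal.ofReal (exp t) * x) ^ q⁻¹
  have hab : a * b = ENNReal.ofReal (exp r) * x ^ q⁻¹ := by
    simp only [a, b]
    rw [ENNReal.mul_rpow_of_nonneg _ _ hpq.symm.inv_nonneg,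
      ENNReal.ofReal_rpow_of_pos (exp_pos t), ← exp_mul, ← mul_assoc,
      ← ENNReal.ofReal_mul (exp_pos _).le, ← exp_add, ← div_eq_mul_inv, sub_add_cancel]
  have ha : a ^ p = ENNReal.ofReal (exp (p * r - (p - 1) * t)) := by
    simp only [a]
    rw [ENNReal.ofReal_rpow_of_pos (exp_pos _), ← exp_mul, ← hpq.div_conj_eq_sub_one]
    ring_nf
  have hb : b ^ q = ENNReal.ofReal (exp t) * x := ENNReal.rpow_inv_rpow hpq.symm.ne_zero _
  calc ENNReal.ofReal (exp r) * x ^ q⁻¹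
      ≤ a ^ p / ENNReal.ofReal p + b ^ q / ENNReal.ofReal q :=
        hab ▸ ENNReal.young_inequality a b hpq
    _ ≤ a ^ p + b ^ q := by
        gcongr <;> refine ENNReal.div_le_of_le_mul (le_mul_of_one_le_right' ?_)
        · exact ENNReal.one_le_ofReal.2 hpq.lt.le
        · exact ENNReal.one_le_ofReal.2 hpq.symm.lt.le
    _ = ENNReal.ofReal (exp t) * x + ENNReal.ofReal (exp (p * r - (p - 1) * t)) := by
        rw [ha, hb, add_comm]

end LqDominated

section Reduction

variable {X : Type u} {Y : Type v} [MeasurableSpace Y] {Nbr : X → X → Prop} {M : Mechanism X Y}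

theorem isCDP_iff {μ τ : ℝ} :
    IsCDP Nbr M μ τ ↔ ∀ x x', Nbr x x' →
      ConcentratedLoss (M x : Measure Y) (M x') μ (‖τ‖₊ ^ 2) := by
  have h_proxy (l : ℝ) : ((‖τ‖₊ ^ 2 : ℝ≥0) : ℝ) * l ^ 2 / 2 = l ^ 2 * τ ^ 2 / 2 := by
    rw [NNReal.coe_pow, coe_nnnorm, norm_eq_abs, sq_abs, mul_comm]
  refine forall₃_congr fun x x' _ => ⟨fun ⟨h_ac, h_int, h_mean, h_mgf⟩ => ?_, fun h => ?_⟩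
  · exact ⟨h_ac, h_int, h_mean,
      ⟨fun l => (h_mgf l).1, fun l => (h_mgf l).2.trans_eq (by rw [h_proxy])⟩⟩
  · refine ⟨h.absolutelyContinuous, h.integrable_llr, h.integral_llr_le, fun l =>
      ⟨h.hasSubgaussianMGF.integrable_exp_mul l, ?_⟩⟩
    rw [← h_proxy]
    exact h.hasSubgaussianMGF.mgf_le l

theorem IsDP.isCDP (hNbr : ∀ x x', Nbr x x' → Nbr x' x) {ε : ℝ} (hε : 0 < ε)
    (h : IsDP Nbr M ε 0) : IsCDP Nbr M (ε * ((exp ε - 1) / (exp ε + 1))) ε := by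
  have h_le (x x' : X) (hx : Nbr x x') :
      (M x : Measure Y) ≤ ENNReal.ofReal (exp ε) • (M x' : Measure Y) :=
    Measure.le_iff.2 fun S hS => by simpa using h x x' hx S hS
  exact isCDP_iff.2 fun x x' hx => .of_le_smul hε (h_le x x' hx) (h_le x' x (hNbr x x' hx))

theorem IsBR.isCDP {α : ℝ} (hα : 0 < α) (h : IsBR Nbr M α) :
    IsCDP Nbr M (α / (exp α - 1) - 1 - log (α / (exp α - 1))) (α / 2) :=
  isCDP_iff.2 fun x x' hx => by
    simpa using ConcentratedLoss.of_mul_le_mul hα (h x x' hx)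

/-- The first parameter of the concentrated differential privacy that the given privacy parameter
implies: an upper bound for the mean privacy loss. -/
noncomputable def PrivacyParam.cdpMean : PrivacyParam → ℝ
  | .pureDP ε => ε * ((exp ε - 1) / (exp ε + 1))
  | .boundedRange α => α / (exp α - 1) - 1 - log (α / (exp α - 1))
  | .cdp μ _ => μ

/-- The second parameter of the concentrated differential privacy that the given privacy parameter
implies: the square root of a sub-Gaussian variance proxy for the privacy loss. -/
noncomputable def PrivacyParam.cdpScale : PrivacyParam → ℝ
  | .pureDP ε => ε
  | .boundedRange α => α / 2
  | .cdp _ τ => τ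

/-- The parameter is in the range in which `PrivacyParam.cdpMean` and `PrivacyParam.cdpScale` have
their meaning: at `α = 0` the former is the junk value `-1`. -/
def PrivacyParam.IsNondegenerate : PrivacyParam → Prop
  | .pureDP ε => 0 < ε
  | .boundedRange α => 0 < α
  | .cdp _ _ => True

theorem PrivacyParam.Admits.isCDP (hNbr : ∀ x x', Nbr x x' → Nbr x' x) {e : PrivacyParam}
    (he : e.IsNondegenerate) (h : e.Admits Nbr M) : IsCDP Nbr M e.cdpMean e.cdpScale :=
  match e, he, h with
  | .pureDP _, hε, h => IsDP.isCDP hNbr hε h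
  | .boundedRange _, hα, h => IsBR.isCDP hα h
  | .cdp _ _, _, h => h

end Reduction

namespace Analyst

variable {X : Type u} {Nbr : X → X → Prop} {ι : Type w} [Fintype ι] {E : ι → PrivacyParam}
  {Y : ℕ → Type v} [∀ n, MeasurableSpace (Y n)]

instance (A : Analyst Nbr E Y) (b : Bool) (n : ℕ) (hn : n ≤ Fintype.card ι) :
    IsProbabilityMeasure (A.historyLaw b n hn) :=
  A.isProbabilityMeasure_historyLaw b n hn

instance (A : Analyst Nbr E Y) (b : Bool) : IsProbabilityMeasure (A.view b) :=
  A.isProbabilityMeasure_historyLaw b _ le_rfl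

theorem nbr_data (A : Analyst Nbr E Y) (hNbr : ∀ x x', Nbr x x' → Nbr x' x) (b : Bool)
    (n : Fin (Fintype.card ι)) (h : History Y n) : Nbr (A.data b n h) (A.data (!b) n h) :=
  match b with
  | false => A.nbr n h
  | true => hNbr _ _ (A.nbr n h)

theorem card_remaining (A : Analyst Nbr E Y) : ∀ (n : ℕ) (hn : n ≤ Fintype.card ι)
    (h : History Y n), (remaining A.select n hn h).card = Fintype.card ι - n
  | 0, _, _ => by simp [remaining, Finset.card_univ]
  | n + 1, hn, h => by
    classical
    rw [remaining, Finset.card_erase_of_mem (A.select_mem ⟨n, hn⟩ h.1), A.card_remaining n,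
      Nat.sub_sub]

theorem remaining_card_eq_empty (A : Analyst Nbr E Y) (h : History Y (Fintype.card ι)) :
    remaining A.select (Fintype.card ι) le_rfl h = ∅ := by
  rw [← Finset.card_eq_zero, A.card_remaining, Nat.sub_self]

theorem measurableSet_mem_remaining (A : Analyst Nbr E Y) (i : ι) :
    ∀ (n : ℕ) (hn : n ≤ Fintype.card ι),
      MeasurableSet {h : History Y n | i ∈ remaining A.select n hn h}
  | 0, _ => by simp [remaining]
  | n + 1, hn => by
    classical
    simp only [remaining, Finset.mem_erase, ne_comm (a := i)]
    exact measurable_fst (α := History Y n) (β := Y n)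
      ((A.measurableSet_select ⟨n, hn⟩ i).compl.inter
        (A.measurableSet_mem_remaining i n (Nat.le_of_succ_le hn)))

theorem measurable_prod_remaining (A : Analyst Nbr E Y) (c : ι → ℝ≥0∞) (n : ℕ)
    (hn : n ≤ Fintype.card ι) :
    Measurable fun h : History Y n => ∏ i ∈ remaining A.select n hn h, c i := by
  classical
  have h_ite (h : History Y n) : ∏ i ∈ remaining A.select n hn h, c i =
      ∏ i, if i ∈ remaining A.select n hn h then c i else 1 := by
    rw [Finset.prod_ite_mem, Finset.univ_inter]
  simp only [h_ite]
  exact Finset.measurable_prod _ fun i _ =>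
    Measurable.ite (A.measurableSet_mem_remaining i n hn) measurable_const measurable_const

theorem lqDominated_historyLaw (A : Analyst Nbr E Y) {b b' : Bool} {q : ℝ} (hq : q ≠ 0)
    {c : ι → ℝ≥0∞} (hc : ∀ (n : ℕ) (hn : n < Fintype.card ι) (h : History Y n),
      LqDominated (A.outcome b n hn h) (A.outcome b' n hn h) q (c (A.select ⟨n, hn⟩ h))) :
    ∀ (n : ℕ) (hn : n ≤ Fintype.card ι),
      LqDominated ((A.historyLaw b n hn).withDensity fun h => ∏ i ∈ remaining A.select n hn h, c i)
        (A.historyLaw b' n hn) q (∏ i, c i)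
  | 0, _ => by
    simp only [historyLaw, remaining, withDensity_const]
    exact lqDominated_dirac_smul hq _ _
  | n + 1, hn => by
    classical
    have hn' : n ≤ Fintype.card ι := Nat.le_of_succ_le hn
    refine LqDominated.compProd hq (A.measurable_prod_remaining c n hn')
      (w' := fun h => ∏ i ∈ (remaining A.select n hn' h).erase (A.select ⟨n, hn⟩ h), c i) ?_
      (fun h => Finset.mul_prod_erase _ c (A.select_mem ⟨n, hn⟩ h))
      (A.lqDominated_historyLaw hq hc n hn') (hc n hn)
    exact A.measurable_prod_remaining c (n + 1) hn

theorem lqDominated_view (A : Analyst Nbr E Y) {b b' : Bool} {q : ℝ} (hq : q ≠ 0)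
    {c : ι → ℝ≥0∞} (hc : ∀ (n : ℕ) (hn : n < Fintype.card ι) (h : History Y n),
      LqDominated (A.outcome b n hn h) (A.outcome b' n hn h) q (c (A.select ⟨n, hn⟩ h))) :
    LqDominated (A.view b) (A.view b') q (∏ i, c i) := by
  simpa only [remaining_card_eq_empty, Finset.prod_empty, ← Pi.one_def, withDensity_one, view] using
    A.lqDominated_historyLaw hq hc _ le_rfl

theorem view_le_of_isNondegenerate (A : Analyst Nbr E Y) (hNbr : ∀ x x', Nbr x x' → Nbr x' x)
    (hE : ∀ i, (E i).IsNondegenerate) (b : Bool) {S : Set (History Y (Fintype.card ι))}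
    (hS : MeasurableSet S) {l : ℝ} (hl : 0 < l) (t : ℝ) :
    A.view b S ≤ ENNReal.ofReal (exp t) * A.view (!b) S +
      ENNReal.ofReal
        (exp (l * ∑ i, (E i).cdpMean + l ^ 2 * (∑ i, (E i).cdpScale ^ 2) / 2 - l * t)) := by
  have hpq : (1 + l).HolderConjugate (1 + l).conjExponent := .conjExponent (by linarith)
  set r : ι → ℝ := fun i =>
    (l * (E i).cdpMean + (‖(E i).cdpScale‖₊ ^ 2 : ℝ≥0) * l ^ 2 / 2) / (1 + l) with hr
  have h_round (n : ℕ) (hn : n < Fintype.card ι) (h : History Y n) :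
      LqDominated (A.outcome b n hn h) (A.outcome (!b) n hn h) (1 + l).conjExponent
        (ENNReal.ofReal (exp (r (A.select ⟨n, hn⟩ h)))) :=
    (isCDP_iff.1 ((A.admits ⟨n, hn⟩ h).isCDP hNbr (hE _)) _ _
      (A.nbr_data hNbr b ⟨n, hn⟩ h)).lqDominated hl.le hpq
  have h_sum : (1 + l) * ∑ i, r i =
      l * ∑ i, (E i).cdpMean + l ^ 2 * (∑ i, (E i).cdpScale ^ 2) / 2 := by
    simp only [hr, ← Finset.sum_div, Finset.sum_add_distrib, ← Finset.mul_sum, ← Finset.sum_mul,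
      NNReal.coe_pow, coe_nnnorm, norm_eq_abs, sq_abs]
    field_simp
  calc A.view b S
      ≤ (∏ i, ENNReal.ofReal (exp (r i))) * A.view (!b) S ^ ((1 + l).conjExponent)⁻¹ :=
        (A.lqDominated_view hpq.symm.ne_zero h_round).measure_le hpq.symm.pos hS
    _ = ENNReal.ofReal (exp (∑ i, r i)) * A.view (!b) S ^ ((1 + l).conjExponent)⁻¹ := by
        rw [← ENNReal.ofReal_prod_of_nonneg fun _ _ => (exp_pos _).le, ← exp_sum]
    _ ≤ ENNReal.ofReal (exp t) * A.view (!b) S +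
          ENNReal.ofReal (exp ((1 + l) * ∑ i, r i - (1 + l - 1) * t)) :=
        ofReal_exp_mul_rpow_inv_le hpq _ t _
    _ = ENNReal.ofReal (exp t) * A.view (!b) S + ENNReal.ofReal
          (exp (l * ∑ i, (E i).cdpMean + l ^ 2 * (∑ i, (E i).cdpScale ^ 2) / 2 - l * t)) := by
        rw [h_sum, add_sub_cancel_left]

end Analyst

section Optimization

theorem exists_pos_le_mul_sub_sq_mul {T L d : ℝ} (hL : 0 < L) (hd : √(2 * T * L) < d) :
    ∃ l, 0 < l ∧ L ≤ l * d - l ^ 2 * T / 2 := by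
  have hd₀ : 0 < d := (sqrt_nonneg _).trans_lt hd
  have h_sq : 2 * T * L < d ^ 2 := (sqrt_lt' hd₀).1 hd
  refine ⟨2 * L / d, by positivity, ?_⟩
  have h_ratio : 2 * T * L / d ^ 2 ≤ 1 := (div_le_one (by positivity)).2 h_sq.le
  calc L ≤ 2 * L - L * (2 * T * L / d ^ 2) := by nlinarith
    _ = 2 * L / d * d - (2 * L / d) ^ 2 * T / 2 := by field_simp

theorem le_ofReal_exp_mul_add_of_forall_gt {x y z : ℝ≥0∞} {t : ℝ} (hy : y ≠ ⊤)
    (h : ∀ s > t, x ≤ ENNReal.ofReal (exp s) * y + z) : x ≤ ENNReal.ofReal (exp t) * y + z := by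
  have h_tendsto : Tendsto (fun s => ENNReal.ofReal (exp s) * y + z) (𝓝[>] t)
      (𝓝 (ENNReal.ofReal (exp t) * y + z)) :=
    ((ENNReal.Tendsto.mul_const (ENNReal.tendsto_ofReal (continuous_exp.tendsto t))
      (.inr hy)).add_const z).mono_left nhdsWithin_le_nhds
  exact ge_of_tendsto h_tendsto (eventually_nhdsWithin_of_forall h)

end Optimization

end PrivacyComposition

theorem mainTheorem2_general {X : Type u} {Nbr : X → X → Prop}
    (hNbr : ∀ x x', Nbr x x' → Nbr x' x) {ι : Type w} [Fintype ι]
    {E : ι → PrivacyComposition.PrivacyParam} (hE : ∀ i, (E i).IsNondegenerate) {δ : ℝ}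
    (hδ : 0 < δ) :
    PrivacyComposition.SetwiseDP.{u, v, w} Nbr E
      ((∑ i, (E i).cdpMean) + √(2 * (∑ i, (E i).cdpScale ^ 2) * Real.log (1 / δ))) δ := by
  intro Y _ A b S hS
  rcases le_or_gt 1 δ with hδ₁ | hδ₁
  · exact MeasureTheory.prob_le_one.trans ((ENNReal.one_le_ofReal.2 hδ₁).trans le_add_self)
  refine PrivacyComposition.le_ofReal_exp_mul_add_of_forall_gt (MeasureTheory.measure_ne_top _ _)
    fun t ht => ?_
  obtain ⟨l, hl, h_log⟩ := PrivacyComposition.exists_pos_le_mul_sub_sq_mul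
    (Real.log_pos (one_lt_one_div hδ hδ₁)) (lt_sub_iff_add_lt'.2 ht)
  refine (A.view_le_of_isNondegenerate hNbr hE b hS hl t).trans ?_
  gcongr
  rw [one_div, Real.log_inv] at h_log
  rw [← Real.le_log_iff_exp_le hδ]
  linarith

theorem mainTheorem2 {X : Type u} (Nbr : X → X → Prop) (hNbr : ∀ x x', Nbr x x' → Nbr x' x) :
    (∀ (k : ℕ) (μ τ : Fin k → ℝ) (δ : ℝ), 0 < δ →
      PrivacyComposition.SetwiseDP.{u, v, 0} Nbr
        (fun i : Fin k => PrivacyComposition.PrivacyParam.cdp (μ i) (τ i))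
        ((∑ i, μ i) + Real.sqrt (2 * (∑ i, τ i ^ 2) * Real.log (1 / δ))) δ) ∧
    (∀ (mDP mBR mCDP : ℕ) (ε α μ τ δ : ℝ), 0 < ε → 0 < α → 0 < δ →
      PrivacyComposition.SetwiseDP.{u, v, 0} Nbr
        (Sum.elim (fun _ : Fin mDP => PrivacyComposition.PrivacyParam.pureDP ε)
          (Sum.elim (fun _ : Fin mBR => PrivacyComposition.PrivacyParam.boundedRange α)
            (fun _ : Fin mCDP => PrivacyComposition.PrivacyParam.cdp μ τ)))
        (mDP * (ε * ((Real.exp ε - 1) / (Real.exp ε + 1)))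
          + mBR * (α / (Real.exp α - 1) - 1 - Real.log (α / (Real.exp α - 1)))
          + mCDP * μ
          + Real.sqrt (2 * (mDP * ε ^ 2 + mBR / 4 * α ^ 2 + mCDP * τ ^ 2) * Real.log (1 / δ)))
        δ) := by
  open PrivacyComposition in
  refine ⟨fun k μ τ δ hδ =>
    mainTheorem2_general hNbr (E := fun i => .cdp (μ i) (τ i)) (fun _ => trivial) hδ,
    fun mDP mBR mCDP ε α μ τ δ hε hα hδ => ?_⟩
  convert mainTheorem2_general hNbr (ι := Fin mDP ⊕ Fin mBR ⊕ Fin mCDP) ?_ hδ using 1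
  · simp only [Fintype.sum_sum_type, Sum.elim_inl, Sum.elim_inr, Finset.sum_const,
      Finset.card_univ, Fintype.card_fin, nsmul_eq_mul, PrivacyParam.cdpMean, PrivacyParam.cdpScale]
    ring_nf
  · rintro (_ | _ | _)
    exacts [hε, hα, trivial]
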